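/- Let $K:[0,1]\times[0,1]\to\mathbb{R}$ be given by $K(x,y)=\frac12-\{1/(xy)\}$ if $0<x,y\le 1$ (where $\{\alpha\}=\alpha-\lfloor\alpha\rfloor$ is the fractional part) and $K(x,y)=0$ if $xy=0$. Let $\phi$ be an eigenfunction of $K$ with eigenvalue $\lambda\in\mathbb{R}$, that is, $\phi:[0,1]\to\mathbb{R}$ is Lebesgue measurable and square-integrable, $\int_0^1\phi(x)^2\,dx>0$, and $$\phi(x)=\lambda\int_0^1 K(x,y)\phi(y)\,dy\quad\text{for every }x\in[0,1]$$ (so that necessarily $\lambda\neq 0$). Then: 1. The function $x\mapsto \phi(x)/x$ is Lebesgue integrable on $[0,1]$. Put $\Phi_1=\int_0^1\frac{\phi(y)}{y}\,dy\in\mathbb{R}$. 2. For every $x\in(0,1)$ such that $1/x$ is not an integer, $\phi$ is differentiable at $x$, and $$\lambda^{-1}x^2\phi'(x)=\Phi_1-\sum_{m>1/x}\frac{1}{m}\,\phi\!\left(\frac{1}{mx}\right),$$ where $m$ runs over integers and the series converges absolutely. 3. For every integer $n\ge 1$, $\phi$ is differentiable on the open interval $\left(\frac1{n+1},\frac1n\right)$,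 its derivative $\phi'$ is continuous there, and $\phi'$ has the finite one-sided limits $$\lim_{x\to\frac1n-}\phi'(x)=\lambda n^2\left(\Phi_1-\sum_{m=n+1}^{\infty}\frac1m\,\phi\!\left(\frac nm\right)\right),$$ $$\lim_{x\to\frac1{n+1}+}\phi'(x)=\lambda (n+1)^2\left(\Phi_1-\sum_{m=n+1}^{\infty}\frac1m\,\phi\!\left(\frac{n+1}m\right)\right),$$ where both series converge absolutely. -/

import Mathlib

open MeasureTheory Set Filter Topology

noncomputable section

/-- The kernel `K` on `[0,1] × [0,1]`: `K(x,y) = 1/2 - {1/(xy)}` when `0 < x, y ≤ 1`, and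
`K(x,y) = 0` when `xy = 0`. (Values outside the unit square are never used.) -/
def kernelK (x y : ℝ) : ℝ :=
  if 0 < x ∧ 0 < y then 1 / 2 - Int.fract ((x * y)⁻¹) else 0

/-- The (semi-)norm `(∫₀¹ f(x)² dx)^(1/2)` of a square-integrable real function on `[0,1]`. -/
def normL2 (f : ℝ → ℝ) : ℝ :=
  Real.sqrt (∫ x in Icc (0 : ℝ) 1, f x ^ 2)

/-- `φ` (restricted to `[0,1]`) is an eigenfunction of `K` with eigenvalue `lam`: it is Lebesgue
measurable and square-integrable on `[0,1]`, has positive norm, and satisfies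
`φ(x) = lam * ∫₀¹ K(x,y) φ(y) dy` at every point `x` of `[0,1]`. -/
structure IsEigenfunction (φ : ℝ → ℝ) (lam : ℝ) : Prop where
  memLp : MemLp φ 2 (volume.restrict (Icc (0 : ℝ) 1))
  norm_pos : 0 < normL2 φ
  eigen : ∀ x ∈ Icc (0 : ℝ) 1, φ x = lam * ∫ y in Icc (0 : ℝ) 1, kernelK x y * φ y

/-- `Φ₁ = ∫₀¹ φ(y)/y dy`. -/
def PhiOne (φ : ℝ → ℝ) : ℝ :=
  ∫ y in Icc (0 : ℝ) 1, φ y / y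

end

/-!
For `x, y > 0` the kernel is `K(x, y) = sawtooth (x * y)` with
`sawtooth t = 1/2 - {1/t} = 1/2 - 1/t + ⌊1/t⌋`.

The main point is the decay of an eigenfunction `φ` at the origin, without which neither `φ y / y`
nor the series in the theorem would be under control. Since `φ` is only known to be square
integrable, the eigenvalue equation is used twice:
`φ x = lam² ∫ K₂(x, z) φ z dz`, where `K₂(x, z) = ∫₀¹ sawtooth (x y) sawtooth (y z) dy`. The factor
`sawtooth (x y)` oscillates around mean zero in `1/y`, and integration by parts against the bounded
primitive `({u} - {u}²) / 2` of `1/2 - {u}` gives `∫ₐᵇ sawtooth (x y) dy = O(x b²)` and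
`∫ₐᵇ sawtooth (x y) / y dy = O(x b)`. Splitting `sawtooth (y z)` into `1/2`, `-1/(yz)` and the
indicators of `y ≤ 1/(kz)` that add up to the floor then gives `K₂(x, z) = O(x / z²)`
(`abs_integral_sawtooth_mul_sawtooth_le`). Interpolating with `|K₂| ≤ 1` yields
`K₂(x, z) = O(x^(1/3) z^(-2/3))`, which is integrable in `z`, so that `φ x = O(x^(1/3))`
(`IsEigenfunction.exists_decay`) and `φ y / y` is integrable.

Now `⌊1/(xy)⌋` can be expanded as a sum of indicators in the eigenvalue equation itself. With
`G t = ∫₀ᵗ φ`, which is `O(t^(4/3))`, this gives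
`φ x = lam (G 1 / 2 - Φ₁ / x + ∑ m ≥ 1, G (min 1 (1/(m x))))`
(`IsEigenfunction.eq_tsum_primitive`). The series converges locally uniformly on `(0, 1]`, hence
`φ` is continuous there and `G' = φ` on `(0, 1)`. For `x` between `1/(n+1)` and `1/n` the terms with
`m ≤ n` are constant, and the others can be differentiated termwise; the differentiated series
converges uniformly up to both endpoints, which gives the one-sided limits of `φ'`.
-/

/-! ### The sawtooth and its antiderivatives -/

/-- The one-variable profile of the kernel: `K(x, y) = sawtooth (x * y)` for `x, y > 0`. -/
noncomputable def sawtooth (t : ℝ) : ℝ := 1 / 2 - Int.fract t⁻¹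

/-- `({1/t} - {1/t}²) / 2`: a continuous function on `t > 0`, with values in `[0, 1/8]`, whose
derivative is `-sawtooth t / t²` away from the points `1/k`. -/
noncomputable def sawtoothPrim (t : ℝ) : ℝ := (Int.fract t⁻¹ - Int.fract t⁻¹ ^ 2) / 2

lemma kernelK_eq_sawtooth {x y : ℝ} (hx : 0 < x) (hy : 0 < y) :
    kernelK x y = sawtooth (x * y) := by
  simp [kernelK, sawtooth, hx, hy]

lemma measurable_sawtooth : Measurable sawtooth := by
  unfold sawtooth; fun_prop

lemma abs_sawtooth_le (t : ℝ) : |sawtooth t| ≤ 1 / 2 := by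
  have h0 := Int.fract_nonneg t⁻¹
  have h1 := Int.fract_lt_one t⁻¹
  unfold sawtooth
  rw [abs_le]; constructor <;> linarith

lemma sawtoothPrim_nonneg (t : ℝ) : 0 ≤ sawtoothPrim t := by
  have h0 := Int.fract_nonneg t⁻¹
  have h1 := Int.fract_lt_one t⁻¹
  unfold sawtoothPrim
  nlinarith

lemma sawtoothPrim_le (t : ℝ) : sawtoothPrim t ≤ 1 / 8 := by
  unfold sawtoothPrim
  nlinarith [sq_nonneg (Int.fract t⁻¹ - 1 / 2)]

lemma continuousOn_sawtoothPrim : ContinuousOn sawtoothPrim (Ioi 0) := by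
  have h : Continuous (fun u : ℝ => (Int.fract u - Int.fract u ^ 2) / 2) :=
    ContinuousOn.comp_fract'' (f := fun v : ℝ => (v - v ^ 2) / 2) (by fun_prop) (by norm_num)
  exact h.comp_continuousOn (continuousOn_inv₀.mono fun t ht => (ne_of_gt ht))

lemma hasDerivAt_sawtoothPrim {t : ℝ} (ht : 0 < t)
    (hk : t ∉ range (fun k : ℤ => (k : ℝ)⁻¹)) :
    HasDerivAt sawtoothPrim (-(sawtooth t / t ^ 2)) t := by
  have hfl : ∀ᶠ s in 𝓝 t, ⌊s⁻¹⌋ = ⌊t⁻¹⌋ := by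
    have h1 : (⌊t⁻¹⌋ : ℝ) < t⁻¹ := by
      refine lt_of_le_of_ne (Int.floor_le _) fun h => hk ⟨⌊t⁻¹⌋, ?_⟩
      simp only [h, inv_inv]
    have h2 : t⁻¹ < ⌊t⁻¹⌋ + 1 := Int.lt_floor_add_one _
    have hc : ContinuousAt (fun s : ℝ => s⁻¹) t := continuousAt_inv₀ ht.ne'
    filter_upwards [hc.eventually (lt_mem_nhds h1), hc.eventually (gt_mem_nhds h2)] with s hs1 hs2
    exact Int.floor_eq_iff.mpr ⟨hs1.le, hs2⟩
  have hd : HasDerivAt (fun s : ℝ => s⁻¹ - (⌊t⁻¹⌋ : ℝ)) (-(t ^ 2)⁻¹) t :=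
    (hasDerivAt_inv ht.ne').sub_const _
  have hd2 := ((hd.sub (hd.pow 2)).div_const 2)
  refine (hd2.congr_of_eventuallyEq ?_).congr_deriv ?_
  · filter_upwards [hfl] with s hs
    simp [sawtoothPrim, Int.fract, hs]
  · simp only [sawtooth, Int.fract]
    generalize (⌊t⁻¹⌋ : ℝ) = c
    norm_num
    field_simp
    ring

lemma intervalIntegrable_sawtooth (a b : ℝ) : IntervalIntegrable sawtooth volume a b :=
  (intervalIntegrable_const (c := (1 / 2 : ℝ))).mono_fun
    measurable_sawtooth.aestronglyMeasurable (.of_forall fun t => by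
      simpa using abs_sawtooth_le t)

lemma intervalIntegrable_sawtooth_div {a b : ℝ} (ha : 0 < a) (hab : a ≤ b) :
    IntervalIntegrable (fun t => sawtooth t / t) volume a b := by
  simp only [div_eq_mul_inv]
  refine (intervalIntegrable_sawtooth a b).mul_continuousOn (continuousOn_inv₀.mono ?_)
  rw [uIcc_of_le hab]
  exact fun t ht => (ha.trans_le ht.1).ne'

lemma intervalIntegrable_sawtoothPrim {a b : ℝ} (ha : 0 < a) (hab : a ≤ b) :
    IntervalIntegrable sawtoothPrim volume a b := by
  refine (continuousOn_sawtoothPrim.mono ?_).intervalIntegrable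
  rw [uIcc_of_le hab]
  exact fun t ht => ha.trans_le ht.1

/-- Integration by parts, `sawtooth t = 2 t S(t) - (t² S(t))'` with `S = sawtoothPrim`, gains a
factor `b` over the trivial bound. -/
lemma abs_integral_sawtooth_le {a b : ℝ} (ha : 0 < a) (hab : a ≤ b) :
    |∫ t in a..b, sawtooth t| ≤ b ^ 2 / 8 := by
  have hi : IntervalIntegrable (fun t => 2 * t * sawtoothPrim t) volume a b :=
    (intervalIntegrable_sawtoothPrim ha hab).continuousOn_mul (by fun_prop)
  have key := integral_eq_of_hasDerivAt_off_countable_of_le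
    (fun t => t ^ 2 * sawtoothPrim t) (fun t => 2 * t * sawtoothPrim t - sawtooth t) hab
    (countable_range (fun k : ℤ => (k : ℝ)⁻¹))
    ((continuousOn_id.pow 2).mul (continuousOn_sawtoothPrim.mono fun t ht => ha.trans_le ht.1))
    (fun t ht => by
      have ht0 : 0 < t := ha.trans ht.1.1
      refine ((hasDerivAt_pow 2 t).mul (hasDerivAt_sawtoothPrim ht0 ht.2)).congr_deriv ?_
      field_simp
      simp
      ring)
    (hi.sub (intervalIntegrable_sawtooth a b))
  rw [intervalIntegral.integral_sub hi (intervalIntegrable_sawtooth a b)] at key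
  have h0 : 0 ≤ ∫ t in a..b, 2 * t * sawtoothPrim t :=
    intervalIntegral.integral_nonneg hab fun t ht =>
      mul_nonneg (by linarith [ht.1]) (sawtoothPrim_nonneg t)
  have h1 : ∫ t in a..b, 2 * t * sawtoothPrim t ≤ ∫ t in a..b, t / 4 := by
    refine intervalIntegral.integral_mono_on hab hi
      (Continuous.intervalIntegrable (by fun_prop) _ _) fun t ht => ?_
    nlinarith [sawtoothPrim_le t, ht.1]
  have h2 : ∫ t in a..b, t / 4 = (b ^ 2 - a ^ 2) / 8 := by
    rw [intervalIntegral.integral_div, integral_id]; ring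
  have ha1 := mul_le_mul_of_nonneg_left (sawtoothPrim_le a) (sq_nonneg a)
  have ha0 := mul_nonneg (sq_nonneg a) (sawtoothPrim_nonneg a)
  have hb1 := mul_le_mul_of_nonneg_left (sawtoothPrim_le b) (sq_nonneg b)
  have hb0 := mul_nonneg (sq_nonneg b) (sawtoothPrim_nonneg b)
  have hab2 : a ^ 2 ≤ b ^ 2 := by gcongr
  rw [abs_le]
  constructor <;> linarith

/-- Integration by parts: `sawtooth t / t = S(t) - (t S(t))'` with `S = sawtoothPrim`. -/
lemma abs_integral_sawtooth_div_le {a b : ℝ} (ha : 0 < a) (hab : a ≤ b) :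
    |∫ t in a..b, sawtooth t / t| ≤ b / 8 := by
  have hi := intervalIntegrable_sawtoothPrim ha hab
  have hj := intervalIntegrable_sawtooth_div ha hab
  have key := integral_eq_of_hasDerivAt_off_countable_of_le
    (fun t => t * sawtoothPrim t) (fun t => sawtoothPrim t - sawtooth t / t) hab
    (countable_range (fun k : ℤ => (k : ℝ)⁻¹))
    (continuousOn_id.mul (continuousOn_sawtoothPrim.mono fun t ht => ha.trans_le ht.1))
    (fun t ht => by
      have ht0 : 0 < t := ha.trans ht.1.1
      refine ((hasDerivAt_id t).mul (hasDerivAt_sawtoothPrim ht0 ht.2)).congr_deriv ?_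
      simp
      field_simp
      ring)
    (hi.sub hj)
  rw [intervalIntegral.integral_sub hi hj] at key
  have h0 : 0 ≤ ∫ t in a..b, sawtoothPrim t :=
    intervalIntegral.integral_nonneg hab fun t _ => sawtoothPrim_nonneg t
  have h1 : ∫ t in a..b, sawtoothPrim t ≤ ∫ t in a..b, (1 / 8 : ℝ) :=
    intervalIntegral.integral_mono_on hab hi
      (Continuous.intervalIntegrable (by fun_prop) _ _) fun t _ => sawtoothPrim_le t
  have h2 : ∫ t in a..b, (1 / 8 : ℝ) = (b - a) / 8 := by
    rw [intervalIntegral.integral_const, smul_eq_mul]; ring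
  have ha1 := mul_le_mul_of_nonneg_left (sawtoothPrim_le a) ha.le
  have ha0 := mul_nonneg ha.le (sawtoothPrim_nonneg a)
  have hb1 := mul_le_mul_of_nonneg_left (sawtoothPrim_le b) (ha.le.trans hab)
  have hb0 := mul_nonneg (ha.le.trans hab) (sawtoothPrim_nonneg b)
  rw [abs_le]
  constructor <;> linarith

lemma abs_integral_sawtooth_mul_le {x a b : ℝ} (hx : 0 < x) (ha : 0 < a) (hab : a ≤ b) :
    |∫ y in a..b, sawtooth (x * y)| ≤ x * b ^ 2 / 8 := by
  rw [intervalIntegral.integral_comp_mul_left _ hx.ne', smul_eq_mul, abs_mul,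
    abs_of_pos (inv_pos.mpr hx)]
  have h := abs_integral_sawtooth_le (mul_pos hx ha) (mul_le_mul_of_nonneg_left hab hx.le)
  rw [inv_mul_le_iff₀ hx]
  refine h.trans (le_of_eq (by ring))

lemma abs_integral_sawtooth_mul_div_le {x a b : ℝ} (hx : 0 < x) (ha : 0 < a) (hab : a ≤ b) :
    |∫ y in a..b, sawtooth (x * y) / y| ≤ x * b / 8 := by
  have h1 : ∫ y in a..b, sawtooth (x * y) / y = ∫ t in x * a..x * b, sawtooth t / t := by
    have h2 : ∀ y, sawtooth (x * y) / y = x * (sawtooth (x * y) / (x * y)) := fun y => by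
      rcases eq_or_ne y 0 with rfl | hy
      · simp
      · field_simp
    simp_rw [h2]
    rw [intervalIntegral.integral_const_mul,
      intervalIntegral.integral_comp_mul_left (fun t => sawtooth t / t) hx.ne', smul_eq_mul,
      mul_inv_cancel_left₀ hx.ne']
  rw [h1]
  exact abs_integral_sawtooth_div_le (mul_pos hx ha) (mul_le_mul_of_nonneg_left hab hx.le)

/-! ### The iterated kernel -/

lemma natFloor_eq_sum_indicator {u : ℝ} (N : ℕ) (hN : ⌊u⌋₊ ≤ N) :
    (⌊u⌋₊ : ℝ) = ∑ k ∈ Finset.range N, if (k : ℝ) + 1 ≤ u then (1 : ℝ) else 0 := by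
  rw [← Finset.sum_filter, Finset.sum_const, nsmul_eq_mul, mul_one]
  have : (Finset.range N).filter (fun k : ℕ => (k : ℝ) + 1 ≤ u) = Finset.range ⌊u⌋₊ := by
    ext k
    have h : (k : ℝ) + 1 ≤ u ↔ k < ⌊u⌋₊ := by
      rw [← Nat.succ_le_iff, Nat.le_floor_iff' (Nat.succ_ne_zero k), Nat.cast_succ]
    simp only [Finset.mem_filter, Finset.mem_range, h]
    exact ⟨fun h => h.2, fun h => ⟨h.trans_le hN, h⟩⟩
  rw [this, Finset.card_range]

lemma sawtooth_eq_natFloor {t : ℝ} (ht : 0 < t) :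
    sawtooth t = 1 / 2 - t⁻¹ + (⌊t⁻¹⌋₊ : ℝ) := by
  have h : (⌊t⁻¹⌋ : ℝ) = (⌊t⁻¹⌋₊ : ℝ) := by
    rw [natCast_floor_eq_intCast_floor (inv_nonneg.mpr ht.le)]
  rw [← h, sawtooth, Int.fract]
  ring

lemma le_inv_mul_iff {k y z : ℝ} (hk : 0 < k) (hy : 0 < y) (hz : 0 < z) :
    k ≤ (y * z)⁻¹ ↔ y ≤ (k * z)⁻¹ := by
  rw [le_inv_comm₀ hk (by positivity), mul_inv, ← div_eq_mul_inv, le_div_iff₀ hz]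

lemma integral_ite_le {f : ℝ → ℝ} {a b c : ℝ} (hab : a ≤ b) (hac : a ≤ c) :
    ∫ y in a..c, (if y ≤ b then f y else 0) = ∫ y in a..min c b, f y := by
  rcases le_total c b with h | h
  · rw [min_eq_left h]
    refine intervalIntegral.integral_congr fun y hy => ?_
    rw [uIcc_of_le hac] at hy
    simp [hy.2.trans h]
  · rw [min_eq_right h, ← intervalIntegral.integral_indicator (f := f) ⟨hab, h⟩]
    rfl

/-- The constant in the bound for the iterated kernel. -/
noncomputable def iterConst : ℝ := 1 + ∑' k : ℕ, 1 / ((k : ℝ) + 1) ^ 2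

lemma summable_one_div_succ_sq : Summable fun k : ℕ => 1 / ((k : ℝ) + 1) ^ 2 := by
  have := (summable_nat_add_iff 1).mpr (Real.summable_one_div_nat_pow.mpr one_lt_two)
  simpa using this

lemma one_le_iterConst : 1 ≤ iterConst :=
  le_add_of_nonneg_right (tsum_nonneg fun k => by positivity)

lemma intervalIntegrable_sawtooth_mul (x a b : ℝ) :
    IntervalIntegrable (fun y => sawtooth (x * y)) volume a b :=
  (intervalIntegrable_const (c := (1 / 2 : ℝ))).mono_fun
    (measurable_sawtooth.comp (measurable_const_mul x)).aestronglyMeasurable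
    (.of_forall fun y => by simpa using abs_sawtooth_le (x * y))

/-- The part of the iterated kernel over `[a, 1]`. The bound does not depend on `a`: the `k`-th
indicator in the floor contributes `O(x / (kz)²)`, which is summable over `k`. -/
lemma abs_integral_sawtooth_mul_sawtooth_le_of_pos {x z a : ℝ} (hx : 0 < x) (hz : 0 < z)
    (hz1 : z ≤ 1) (ha : 0 < a) (ha1 : a ≤ 1) :
    |∫ y in a..1, sawtooth (x * y) * sawtooth (y * z)| ≤ iterConst * (x / z ^ 2) := by
  set N := ⌊(a * z)⁻¹⌋₊ with hN
  have hint := intervalIntegrable_sawtooth_mul x a 1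
  have hdiv : IntervalIntegrable (fun y => sawtooth (x * y) / y) volume a 1 := by
    simp only [div_eq_mul_inv]
    refine hint.mul_continuousOn (continuousOn_inv₀.mono ?_)
    rw [uIcc_of_le ha1]
    exact fun t ht => (ha.trans_le ht.1).ne'
  have hite : ∀ k ∈ Finset.range N, IntervalIntegrable
      (fun y => if y ≤ (((k : ℝ) + 1) * z)⁻¹ then sawtooth (x * y) else 0) volume a 1 :=
    fun k _ => hint.mono_fun
      ((Measurable.ite measurableSet_Iic
        (measurable_sawtooth.comp (measurable_const_mul x)) measurable_const).aestronglyMeasurable)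
      (.of_forall fun y => by
        dsimp only
        split_ifs <;> simp)
  have hexp : ∫ y in a..1, sawtooth (x * y) * sawtooth (y * z) =
      (1 / 2) * (∫ y in a..1, sawtooth (x * y)) - z⁻¹ * (∫ y in a..1, sawtooth (x * y) / y) +
      ∑ k ∈ Finset.range N,
        ∫ y in a..1, (if y ≤ (((k : ℝ) + 1) * z)⁻¹ then sawtooth (x * y) else 0) := by
    rw [← intervalIntegral.integral_finsetSum hite, ← intervalIntegral.integral_const_mul,
      ← intervalIntegral.integral_const_mul, ← intervalIntegral.integral_sub
        (hint.const_mul _) (hdiv.const_mul _), ← intervalIntegral.integral_add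
        ((hint.const_mul _).sub (hdiv.const_mul _)) ]
    · refine intervalIntegral.integral_congr fun y hy => ?_
      rw [uIcc_of_le ha1] at hy
      have hy0 : 0 < y := ha.trans_le hy.1
      have hfl : ⌊(y * z)⁻¹⌋₊ ≤ N := Nat.floor_mono (by gcongr; exact hy.1)
      rw [sawtooth_eq_natFloor (mul_pos hy0 hz), natFloor_eq_sum_indicator N hfl, mul_add,
        Finset.mul_sum]
      congr 1
      · field_simp
      · refine Finset.sum_congr rfl fun k _ => ?_
        simp only [le_inv_mul_iff (Nat.cast_add_one_pos k) hy0 hz, mul_ite, mul_one, mul_zero]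
    · have h := IntervalIntegrable.sum (Finset.range N) hite
      rwa [Finset.sum_fn] at h
  have h1 := abs_integral_sawtooth_mul_le hx ha ha1
  have h2 := abs_integral_sawtooth_mul_div_le hx ha ha1
  have h3 : ∀ k ∈ Finset.range N,
      |∫ y in a..1, (if y ≤ (((k : ℝ) + 1) * z)⁻¹ then sawtooth (x * y) else 0)| ≤
        x / z ^ 2 / 8 * (1 / ((k : ℝ) + 1) ^ 2) := by
    intro k hk
    have hk0 : (0 : ℝ) < (k : ℝ) + 1 := Nat.cast_add_one_pos k
    have hak : a ≤ (((k : ℝ) + 1) * z)⁻¹ := by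
      rw [← le_inv_mul_iff hk0 ha hz]
      have := Nat.succ_le_of_lt (Finset.mem_range.mp hk)
      rw [Nat.le_floor_iff' (Nat.succ_ne_zero k)] at this
      simpa using this
    rw [integral_ite_le hak ha1]
    refine (abs_integral_sawtooth_mul_le hx ha (le_min ha1 hak)).trans ?_
    have hm : (min 1 (((k : ℝ) + 1) * z)⁻¹) ^ 2 ≤ ((((k : ℝ) + 1) * z)⁻¹) ^ 2 :=
      pow_le_pow_left₀ (le_min zero_le_one (by positivity)) (min_le_right _ _) 2
    calc x * (min 1 (((k : ℝ) + 1) * z)⁻¹) ^ 2 / 8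
        ≤ x * ((((k : ℝ) + 1) * z)⁻¹) ^ 2 / 8 := by gcongr
      _ = _ := by field_simp
  have h4 : |∑ k ∈ Finset.range N,
      ∫ y in a..1, (if y ≤ (((k : ℝ) + 1) * z)⁻¹ then sawtooth (x * y) else 0)| ≤
        x / z ^ 2 / 8 * ∑' k : ℕ, 1 / ((k : ℝ) + 1) ^ 2 := by
    refine (Finset.abs_sum_le_sum_abs _ _).trans ((Finset.sum_le_sum h3).trans ?_)
    rw [← Finset.mul_sum]
    have := summable_one_div_succ_sq.sum_le_tsum (Finset.range N) fun k _ => by positivity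
    gcongr
  have h5 : x ≤ x / z ^ 2 := by
    rw [le_div_iff₀ (by positivity)]
    exact mul_le_of_le_one_right hx.le (pow_le_one₀ hz.le hz1)
  have h6 : z⁻¹ * x ≤ x / z ^ 2 := by
    rw [le_div_iff₀ (by positivity)]
    have : z⁻¹ * x * z ^ 2 = x * z := by field_simp
    rw [this]
    exact mul_le_of_le_one_right hx.le hz1
  have h7 : |z⁻¹ * (∫ y in a..1, sawtooth (x * y) / y)| ≤ x / z ^ 2 / 8 := by
    rw [abs_mul, abs_of_pos (inv_pos.mpr hz)]
    have := mul_le_mul_of_nonneg_left h2 (inv_pos.mpr hz).le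
    linarith
  have hS : 0 ≤ x / z ^ 2 * ∑' k : ℕ, 1 / ((k : ℝ) + 1) ^ 2 :=
    mul_nonneg (by positivity) (tsum_nonneg fun k => by positivity)
  have hq : 0 < x / z ^ 2 := by positivity
  rw [hexp, iterConst]
  rw [abs_le] at h1 h4 h7 ⊢
  constructor <;> linarith

/-- Decay of the iterated kernel `∫₀¹ K(x, y) K(y, z) dy` as `x → 0`: on `[a, 1]` the function
`K(·, z)` is smooth apart from finitely many jumps, so the cancellation in `K(x, ·)` can be used;
then `a → 0`. -/
lemma abs_integral_sawtooth_mul_sawtooth_le {x z : ℝ} (hx : 0 < x) (hz : 0 < z) (hz1 : z ≤ 1) :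
    |∫ y in (0 : ℝ)..1, sawtooth (x * y) * sawtooth (y * z)| ≤ iterConst * (x / z ^ 2) := by
  have hle : ∀ y, ‖sawtooth (x * y) * sawtooth (y * z)‖ ≤ 1 := fun y => by
    rw [norm_mul, Real.norm_eq_abs, Real.norm_eq_abs]
    nlinarith [abs_sawtooth_le (x * y), abs_sawtooth_le (y * z), abs_nonneg (sawtooth (x * y)),
      abs_nonneg (sawtooth (y * z))]
  have hint : ∀ a b, IntervalIntegrable (fun y => sawtooth (x * y) * sawtooth (y * z))
      volume a b := fun a b =>
    (intervalIntegrable_const (c := (1 : ℝ))).mono_fun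
      ((measurable_sawtooth.comp (measurable_const_mul x)).mul
        (measurable_sawtooth.comp (measurable_mul_const z))).aestronglyMeasurable
      (.of_forall fun y => by simpa using hle y)
  refine le_of_forall_pos_le_add fun ε hε => ?_
  have ha : 0 < min ε 1 := lt_min hε one_pos
  rw [← intervalIntegral.integral_add_adjacent_intervals (hint 0 (min ε 1)) (hint _ 1)]
  have h1 : |∫ y in (0 : ℝ)..min ε 1, sawtooth (x * y) * sawtooth (y * z)| ≤ ε := by
    have := intervalIntegral.norm_integral_le_of_norm_le_const (a := 0) (b := min ε 1)
      fun y _ => hle y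
    rw [Real.norm_eq_abs, sub_zero, abs_of_pos ha, one_mul] at this
    exact this.trans (min_le_left _ _)
  have h2 := abs_integral_sawtooth_mul_sawtooth_le_of_pos hx hz hz1 ha (min_le_right _ _)
  exact (abs_add_le _ _).trans (by linarith)

/-! ### Decay of eigenfunctions at the origin -/

namespace IsEigenfunction

variable {φ : ℝ → ℝ} {lam : ℝ}

lemma integrableOn (hφ : IsEigenfunction φ lam) : IntegrableOn φ (Ioc 0 1) volume :=
  IntegrableOn.mono_set (hφ.memLp.integrable one_le_two) Ioc_subset_Icc_self

lemma lam_ne_zero (hφ : IsEigenfunction φ lam) : lam ≠ 0 := by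
  rintro rfl
  have h : ∫ x in Icc (0 : ℝ) 1, φ x ^ 2 = 0 :=
    setIntegral_eq_zero_of_forall_eq_zero fun x hx => by simp [hφ.eigen x hx]
  have := hφ.norm_pos
  simp [normL2, h] at this

lemma eq_integral_sawtooth (hφ : IsEigenfunction φ lam) {x : ℝ} (hx : x ∈ Ioc (0 : ℝ) 1) :
    φ x = lam * ∫ y in Ioc (0 : ℝ) 1, sawtooth (x * y) * φ y := by
  rw [hφ.eigen x ⟨hx.1.le, hx.2⟩, integral_Icc_eq_integral_Ioc]
  congr 1
  exact setIntegral_congr_fun measurableSet_Ioc fun y hy => by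
    simp only [kernelK_eq_sawtooth hx.1 hy.1]

lemma exists_bound (hφ : IsEigenfunction φ lam) :
    ∃ M, 0 ≤ M ∧ ∀ x ∈ Ioc (0 : ℝ) 1, |φ x| ≤ M := by
  refine ⟨|lam| * ∫ y in Ioc (0 : ℝ) 1, |φ y|,
    mul_nonneg (abs_nonneg _) (integral_nonneg fun y => abs_nonneg _), fun x hx => ?_⟩
  rw [hφ.eq_integral_sawtooth hx, abs_mul]
  have hb := norm_integral_le_of_norm_le (f := fun y => sawtooth (x * y) * φ y)
    hφ.integrableOn.abs (.of_forall fun y => by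
      rw [norm_mul, Real.norm_eq_abs, Real.norm_eq_abs]
      exact mul_le_of_le_one_left (abs_nonneg _) ((abs_sawtooth_le _).trans (by norm_num)))
  exact mul_le_mul_of_nonneg_left hb (abs_nonneg _)

/-- An eigenfunction is reproduced by the iterated kernel. -/
lemma eq_integral_iterate (hφ : IsEigenfunction φ lam) {x : ℝ} (hx : x ∈ Ioc (0 : ℝ) 1) :
    φ x = lam ^ 2 * ∫ z in Ioc (0 : ℝ) 1,
      (∫ y in (0 : ℝ)..1, sawtooth (x * y) * sawtooth (y * z)) * φ z := by
  have h1 : φ x = lam ^ 2 * ∫ y in Ioc (0 : ℝ) 1, ∫ z in Ioc (0 : ℝ) 1,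
      sawtooth (x * y) * sawtooth (y * z) * φ z := by
    rw [hφ.eq_integral_sawtooth hx, pow_two, mul_assoc]
    congr 1
    rw [← integral_const_mul]
    refine setIntegral_congr_fun measurableSet_Ioc fun y hy => ?_
    rw [hφ.eq_integral_sawtooth hy]
    simp_rw [mul_assoc]
    rw [integral_const_mul]
    ring
  have hint : Integrable (Function.uncurry fun y z => sawtooth (x * y) * sawtooth (y * z) * φ z)
      ((volume.restrict (Ioc (0 : ℝ) 1)).prod (volume.restrict (Ioc (0 : ℝ) 1))) := by
    have h2 : Integrable (fun p : ℝ × ℝ => φ p.2)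
        ((volume.restrict (Ioc (0 : ℝ) 1)).prod (volume.restrict (Ioc (0 : ℝ) 1))) :=
      Integrable.comp_snd hφ.integrableOn _
    refine h2.bdd_mul (c := 1) (f := fun p : ℝ × ℝ => sawtooth (x * p.1) * sawtooth (p.1 * p.2))
      ?_ (.of_forall fun p => ?_)
    · exact ((measurable_sawtooth.comp (measurable_fst.const_mul x)).mul
        (measurable_sawtooth.comp (measurable_fst.mul measurable_snd))).aestronglyMeasurable
    · rw [norm_mul, Real.norm_eq_abs, Real.norm_eq_abs]
      nlinarith [abs_sawtooth_le (x * p.1), abs_sawtooth_le (p.1 * p.2),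
        abs_nonneg (sawtooth (x * p.1)), abs_nonneg (sawtooth (p.1 * p.2))]
  rw [h1, integral_integral_swap hint]
  simp_rw [integral_mul_const, intervalIntegral.integral_of_le zero_le_one]

lemma intervalIntegrable_rpow_neg_two_thirds :
    IntervalIntegrable (fun z : ℝ => z ^ (-(2 / 3) : ℝ)) volume 0 1 :=
  intervalIntegral.intervalIntegrable_rpow' (by norm_num)

/-- Interpolation of the bounds `iterConst * (x / z ^ 2)` and `1` with exponents `1/3` and `2/3`:
any first exponent below `1/2` makes the resulting power of `z` integrable at `0`. -/
lemma abs_integral_sawtooth_mul_sawtooth_le_rpow {x z : ℝ} (hx : 0 < x) (hz : 0 < z)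
    (hz1 : z ≤ 1) :
    |∫ y in (0 : ℝ)..1, sawtooth (x * y) * sawtooth (y * z)| ≤
      iterConst ^ (1 / 3 : ℝ) * x ^ (1 / 3 : ℝ) * z ^ (-(2 / 3) : ℝ) := by
  have hc : 0 < iterConst := zero_lt_one.trans_le one_le_iterConst
  set q := iterConst * (x / z ^ 2) with hq
  have hq0 : 0 < q := by positivity
  have h1 := abs_integral_sawtooth_mul_sawtooth_le hx hz hz1
  have h2 : |∫ y in (0 : ℝ)..1, sawtooth (x * y) * sawtooth (y * z)| ≤ 1 := by
    have := intervalIntegral.norm_integral_le_of_norm_le_const (a := 0) (b := 1) (C := 1)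
      (f := fun y => sawtooth (x * y) * sawtooth (y * z)) fun y _ => by
        rw [norm_mul, Real.norm_eq_abs, Real.norm_eq_abs]
        nlinarith [abs_sawtooth_le (x * y), abs_sawtooth_le (y * z),
          abs_nonneg (sawtooth (x * y)), abs_nonneg (sawtooth (y * z))]
    simpa using this
  have h3 : q ^ (1 / 3 : ℝ) =
      iterConst ^ (1 / 3 : ℝ) * x ^ (1 / 3 : ℝ) * z ^ (-(2 / 3) : ℝ) := by
    rw [hq, Real.mul_rpow hc.le (by positivity), Real.div_rpow hx.le (by positivity),
      ← Real.rpow_natCast, ← Real.rpow_mul hz.le, Real.rpow_neg hz.le]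
    norm_num
    ring
  rw [← h3]
  rcases le_total q 1 with hq1 | hq1
  · exact h1.trans (Real.self_le_rpow_of_le_one hq0.le hq1 (by norm_num))
  · exact h2.trans (Real.one_le_rpow hq1 (by norm_num))

/-- Eigenfunctions decay at the origin, because the iterated kernel does. -/
lemma exists_decay (hφ : IsEigenfunction φ lam) :
    ∃ C, 0 ≤ C ∧ ∀ x ∈ Ioc (0 : ℝ) 1, |φ x| ≤ C * x ^ (1 / 3 : ℝ) := by
  obtain ⟨M, hM0, hM⟩ := hφ.exists_bound
  have hc : 0 < iterConst := zero_lt_one.trans_le one_le_iterConst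
  have hI : IntegrableOn (fun z : ℝ => z ^ (-(2 / 3) : ℝ)) (Ioc 0 1) volume :=
    (intervalIntegrable_iff_integrableOn_Ioc_of_le zero_le_one).mp
      intervalIntegrable_rpow_neg_two_thirds
  refine ⟨lam ^ 2 * (iterConst ^ (1 / 3 : ℝ) * M *
    ∫ z in Ioc (0 : ℝ) 1, z ^ (-(2 / 3) : ℝ)), ?_, fun x hx => ?_⟩
  · have : 0 ≤ ∫ z in Ioc (0 : ℝ) 1, z ^ (-(2 / 3) : ℝ) :=
      setIntegral_nonneg measurableSet_Ioc fun z hz => Real.rpow_nonneg hz.1.le _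
    positivity
  · have hx0 := hx.1
    rw [hφ.eq_integral_iterate hx, abs_mul, abs_of_nonneg (sq_nonneg lam), mul_assoc (lam ^ 2)]
    gcongr
    have hb := norm_integral_le_of_norm_le
      (f := fun z => (∫ y in (0 : ℝ)..1, sawtooth (x * y) * sawtooth (y * z)) * φ z)
      (hI.const_mul (iterConst ^ (1 / 3 : ℝ) * M * x ^ (1 / 3 : ℝ)))
      ((ae_restrict_iff' measurableSet_Ioc).mpr (.of_forall fun z hz => by
        rw [norm_mul, Real.norm_eq_abs, Real.norm_eq_abs]
        have h := mul_le_mul (abs_integral_sawtooth_mul_sawtooth_le_rpow hx0 hz.1 hz.2) (hM z hz)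
          (abs_nonneg _) (by have := hz.1; positivity)
        exact h.trans (le_of_eq (by ring))))
    rw [integral_const_mul, Real.norm_eq_abs] at hb
    exact hb.trans (le_of_eq (by ring))

lemma integrableOn_div (hφ : IsEigenfunction φ lam) :
    IntegrableOn (fun y => φ y / y) (Ioc 0 1) volume := by
  obtain ⟨C, hC0, hC⟩ := hφ.exists_decay
  have hI : IntegrableOn (fun z : ℝ => z ^ (-(2 / 3) : ℝ)) (Ioc 0 1) volume :=
    (intervalIntegrable_iff_integrableOn_Ioc_of_le zero_le_one).mp
      intervalIntegrable_rpow_neg_two_thirds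
  refine (hI.const_mul C).mono' ?_ ?_
  · simp only [div_eq_mul_inv]
    exact hφ.integrableOn.aestronglyMeasurable.mul measurable_inv.aestronglyMeasurable
  · refine (ae_restrict_iff' measurableSet_Ioc).mpr (.of_forall fun y hy => ?_)
    rw [norm_div, Real.norm_eq_abs, Real.norm_eq_abs, abs_of_pos hy.1, div_le_iff₀ hy.1]
    refine (hC y hy).trans (le_of_eq ?_)
    rw [mul_assoc, ← Real.rpow_add_one hy.1.ne']
    norm_num

end IsEigenfunction

/-! ### Expansion of eigenfunctions in terms of their primitive -/

namespace IsEigenfunction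

variable {φ : ℝ → ℝ} {lam : ℝ}

lemma intervalIntegrable_of_mem (hφ : IsEigenfunction φ lam) {t : ℝ} (ht : t ∈ Icc (0 : ℝ) 1) :
    IntervalIntegrable φ volume 0 t :=
  (intervalIntegrable_iff_integrableOn_Ioc_of_le ht.1).mpr
    (hφ.integrableOn.mono_set (Ioc_subset_Ioc_right ht.2))

lemma integral_abs_le {C t : ℝ} (hC0 : 0 ≤ C)
    (hC : ∀ x ∈ Ioc (0 : ℝ) 1, |φ x| ≤ C * x ^ (1 / 3 : ℝ)) (ht : t ∈ Icc (0 : ℝ) 1) :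
    |∫ y in (0 : ℝ)..t, φ y| ≤ C * t ^ (4 / 3 : ℝ) ∧
      ∫ y in (0 : ℝ)..t, |φ y| ≤ C * t ^ (4 / 3 : ℝ) := by
  have hb : ∀ y ∈ uIoc 0 t, |φ y| ≤ C * t ^ (1 / 3 : ℝ) := fun y hy => by
    rw [uIoc_of_le ht.1] at hy
    refine (hC y ⟨hy.1, hy.2.trans ht.2⟩).trans ?_
    have := Real.rpow_le_rpow hy.1.le hy.2 (by norm_num : (0 : ℝ) ≤ 1 / 3)
    gcongr
  have he : C * t ^ (1 / 3 : ℝ) * |t - 0| = C * t ^ (4 / 3 : ℝ) := by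
    rw [sub_zero, abs_of_nonneg ht.1, mul_assoc, ← Real.rpow_add_one' ht.1 (by norm_num)]
    norm_num
  rw [← he]
  have h1 := intervalIntegral.norm_integral_le_of_norm_le_const (f := φ) hb
  have h2 := intervalIntegral.norm_integral_le_of_norm_le_const (f := fun y => |φ y|)
    fun y hy => (Real.norm_eq_abs _).trans_le ((abs_abs (φ y)).trans_le (hb y hy))
  exact ⟨h1, (le_abs_self _).trans h2⟩

lemma summable_inv_mul_rpow {x : ℝ} (hx : 0 < x) :
    Summable fun m : ℕ => ((((m : ℝ) + 1) * x)⁻¹) ^ (4 / 3 : ℝ) := by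
  have h := (summable_nat_add_iff 1).mpr
    (Real.summable_one_div_nat_rpow.mpr (by norm_num : (1 : ℝ) < 4 / 3))
  refine (h.mul_right ((x⁻¹) ^ (4 / 3 : ℝ))).congr fun m => ?_
  have hm : (0 : ℝ) < (m : ℝ) + 1 := Nat.cast_add_one_pos m
  rw [mul_inv, Real.mul_rpow (by positivity) (by positivity), Real.inv_rpow hm.le]
  push_cast
  rw [one_div]

lemma min_one_inv_mem {x : ℝ} (hx : 0 < x) (m : ℕ) :
    min 1 (((m : ℝ) + 1) * x)⁻¹ ∈ Icc (0 : ℝ) 1 :=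
  ⟨le_min zero_le_one (by positivity), min_le_left _ _⟩

lemma min_one_rpow_le {b : ℝ} (hb : 0 ≤ b) : (min 1 b) ^ (4 / 3 : ℝ) ≤ b ^ (4 / 3 : ℝ) :=
  Real.rpow_le_rpow (le_min zero_le_one hb) (min_le_right _ _) (by norm_num)

/-- The sum over `m` of the primitive of `φ` at `1/(mx)` counts `φ y` with multiplicity
`⌊1/(xy)⌋`. -/
lemma hasSum_primitive (hφ : IsEigenfunction φ lam) {x : ℝ} (hx : 0 < x) :
    HasSum (fun m : ℕ => ∫ y in (0 : ℝ)..min 1 (((m : ℝ) + 1) * x)⁻¹, φ y)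
      (∫ y in Ioc (0 : ℝ) 1, (⌊(x * y)⁻¹⌋₊ : ℝ) * φ y) := by
  obtain ⟨C, hC0, hC⟩ := hφ.exists_decay
  set F : ℕ → ℝ → ℝ := fun m y => if y ≤ (((m : ℝ) + 1) * x)⁻¹ then φ y else 0 with hF
  have hb : ∀ m : ℕ, 0 ≤ (((m : ℝ) + 1) * x)⁻¹ := fun m => by positivity
  have hFint : ∀ m, Integrable (F m) (volume.restrict (Ioc (0 : ℝ) 1)) := fun m =>
    hφ.integrableOn.indicator (measurableSet_Iic (a := (((m : ℝ) + 1) * x)⁻¹))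
  have hFs : Summable fun m => ∫ y, ‖F m y‖ ∂(volume.restrict (Ioc (0 : ℝ) 1)) := by
    refine Summable.of_nonneg_of_le (fun m => integral_nonneg fun y => norm_nonneg _)
      (fun m => ?_) ((summable_inv_mul_rpow hx).mul_left C)
    have h1 : ∀ y, ‖F m y‖ = if y ≤ (((m : ℝ) + 1) * x)⁻¹ then |φ y| else 0 := fun y => by
      simp only [hF]
      split_ifs <;> simp
    simp_rw [h1]
    rw [← intervalIntegral.integral_of_le zero_le_one, integral_ite_le (hb m) zero_le_one]
    exact (integral_abs_le hC0 hC (min_one_inv_mem hx m)).2.trans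
      (mul_le_mul_of_nonneg_left (min_one_rpow_le (hb m)) hC0)
  have hsum := hasSum_integral_of_summable_integral_norm hFint hFs
  have h2 : ∀ m, ∫ y, F m y ∂(volume.restrict (Ioc (0 : ℝ) 1)) =
      ∫ y in (0 : ℝ)..min 1 (((m : ℝ) + 1) * x)⁻¹, φ y := fun m => by
    rw [← integral_ite_le (hb m) zero_le_one, intervalIntegral.integral_of_le zero_le_one]
  simp_rw [h2] at hsum
  suffices h : ∫ y in Ioc (0 : ℝ) 1, (⌊(x * y)⁻¹⌋₊ : ℝ) * φ y =
      ∫ y in Ioc (0 : ℝ) 1, ∑' m, F m y by rwa [h]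
  refine setIntegral_congr_fun measurableSet_Ioc fun y hy => ?_
  have hite : ∀ m : ℕ, F m y = if (m : ℝ) + 1 ≤ (x * y)⁻¹ then φ y else 0 := fun m => by
    simp only [hF, mul_comm x y, le_inv_mul_iff (Nat.cast_add_one_pos m) hy.1 hx]
  simp only [hite]
  rw [tsum_eq_sum (s := Finset.range ⌊(x * y)⁻¹⌋₊), natFloor_eq_sum_indicator _ le_rfl,
    Finset.sum_mul]
  · exact Finset.sum_congr rfl fun m _ => by rw [ite_mul, one_mul, zero_mul]
  · intro m hm
    rw [if_neg]
    intro h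
    refine hm (Finset.mem_range.mpr ?_)
    rw [← Nat.succ_le_iff, Nat.le_floor_iff' (Nat.succ_ne_zero m), Nat.cast_succ]
    exact h

lemma phiOne_eq : PhiOne φ = ∫ y in Ioc (0 : ℝ) 1, φ y / y :=
  integral_Icc_eq_integral_Ioc

/-- The eigenvalue equation with `K(x, y) = 1/2 - 1/(xy) + ⌊1/(xy)⌋` expanded. -/
lemma eq_tsum_primitive (hφ : IsEigenfunction φ lam) {x : ℝ} (hx : x ∈ Ioc (0 : ℝ) 1) :
    φ x = lam * ((∫ y in (0 : ℝ)..1, φ y) / 2 - PhiOne φ / x +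
      ∑' m : ℕ, ∫ y in (0 : ℝ)..min 1 (((m : ℝ) + 1) * x)⁻¹, φ y) := by
  have hx0 := hx.1
  have hi1 := hφ.integrableOn
  have hi2 := hφ.integrableOn_div
  have hs : Integrable (fun y => sawtooth (x * y) * φ y) (volume.restrict (Ioc (0 : ℝ) 1)) :=
    hi1.bdd_mul (c := 1 / 2)
      (measurable_sawtooth.comp (measurable_const_mul x)).aestronglyMeasurable
      (.of_forall fun y => abs_sawtooth_le (x * y))
  have hpt : EqOn (fun y => (⌊(x * y)⁻¹⌋₊ : ℝ) * φ y)
      (fun y => sawtooth (x * y) * φ y - (2⁻¹ * φ y - x⁻¹ * (φ y / y))) (Ioc 0 1) :=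
    fun y hy => by
      have hy0 := hy.1
      simp only [sawtooth_eq_natFloor (mul_pos hx0 hy0)]
      field_simp
      ring
  have hsub : Integrable (fun y => 2⁻¹ * φ y - x⁻¹ * (φ y / y))
      (volume.restrict (Ioc (0 : ℝ) 1)) := (hi1.const_mul _).sub (hi2.const_mul _)
  rw [(hφ.hasSum_primitive hx0).tsum_eq, setIntegral_congr_fun measurableSet_Ioc hpt,
    integral_sub hs hsub,
    integral_sub (hi1.const_mul _) (hi2.const_mul _), integral_const_mul, integral_const_mul,
    ← phiOne_eq, intervalIntegral.integral_of_le zero_le_one, hφ.eq_integral_sawtooth hx]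
  ring

lemma continuousOn_primitive (hφ : IsEigenfunction φ lam) :
    ContinuousOn (fun t => ∫ y in (0 : ℝ)..t, φ y) (Icc 0 1) := by
  have h := intervalIntegral.continuousOn_primitive_interval (μ := volume) (f := φ)
    (a := 0) (b := 1) (by
      rw [uIcc_of_le zero_le_one]
      exact hφ.memLp.integrable one_le_two)
  rwa [uIcc_of_le zero_le_one] at h

/-- Eigenfunctions are continuous away from the origin: the expansion over the primitive
converges locally uniformly. -/
lemma continuousOn (hφ : IsEigenfunction φ lam) : ContinuousOn φ (Ioc 0 1) := by
  obtain ⟨C, hC0, hC⟩ := hφ.exists_decay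
  have key : ∀ δ : ℝ, 0 < δ → ContinuousOn φ (Icc δ 1) := fun δ hδ => by
    have hpos : ∀ x ∈ Icc δ 1, 0 < x := fun x hx => hδ.trans_le hx.1
    have hser : ContinuousOn (fun x : ℝ =>
        ∑' m : ℕ, ∫ y in (0 : ℝ)..min 1 (((m : ℝ) + 1) * x)⁻¹, φ y) (Icc δ 1) := by
      refine continuousOn_tsum (u := fun m : ℕ => C * ((((m : ℝ) + 1) * δ)⁻¹) ^ (4 / 3 : ℝ))
        (fun m => ?_) ((summable_inv_mul_rpow hδ).mul_left C) fun m x hx => ?_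
      · refine hφ.continuousOn_primitive.comp (t := Icc 0 1)
          (f := fun x : ℝ => min 1 (((m : ℝ) + 1) * x)⁻¹) ?_
          fun x hx => min_one_inv_mem (hpos x hx) m
        refine continuousOn_const.inf (ContinuousOn.inv₀ (by fun_prop) fun x hx => ?_)
        have := hpos x hx
        positivity
      · have hx0 := hpos x hx
        have hb : (((m : ℝ) + 1) * x)⁻¹ ≤ (((m : ℝ) + 1) * δ)⁻¹ := by
          gcongr
          exact hx.1
        refine (integral_abs_le hC0 hC (min_one_inv_mem hx0 m)).1.trans
          (mul_le_mul_of_nonneg_left ((min_one_rpow_le (by positivity)).trans ?_) hC0)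
        exact Real.rpow_le_rpow (by positivity) hb (by norm_num)
    refine ContinuousOn.congr (f := fun x => lam * ((∫ y in (0 : ℝ)..1, φ y) / 2 - PhiOne φ / x +
      ∑' m : ℕ, ∫ y in (0 : ℝ)..min 1 (((m : ℝ) + 1) * x)⁻¹, φ y)) ?_
      fun x hx => hφ.eq_tsum_primitive ⟨hpos x hx, hx.2⟩
    exact continuousOn_const.mul ((continuousOn_const.sub
      (continuousOn_const.div continuousOn_id fun x hx => (hpos x hx).ne')).add hser)
  intro x hx
  refine (key (x / 2) (half_pos hx.1) x ⟨by linarith [hx.1], hx.2⟩).mono_of_mem_nhdsWithin ?_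
  filter_upwards [mem_nhdsWithin_of_mem_nhds (Ioi_mem_nhds (half_lt_self hx.1)),
    self_mem_nhdsWithin] with y hy1 hy2
  exact ⟨(mem_Ioi.mp hy1).le, hy2.2⟩

end IsEigenfunction

/-! ### Termwise differentiation between consecutive reciprocals -/

namespace IsEigenfunction

variable {φ : ℝ → ℝ} {lam : ℝ}

/-- `1 / (m x)` with `m = k + n + 1`: the arguments occurring in the series for `φ'` on
`(1/(n+1), 1/n)`. -/
noncomputable def node (n k : ℕ) (x : ℝ) : ℝ := (((k + n : ℕ) + 1 : ℝ) * x)⁻¹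

/-- The function on `[1/(n+1), 1/n]` that agrees with `φ'` on the interior. -/
noncomputable def derivFormula (φ : ℝ → ℝ) (lam : ℝ) (n : ℕ) (x : ℝ) : ℝ :=
  lam * (PhiOne φ / x ^ 2 - (∑' k : ℕ, φ (node n k x) * node n k x) / x)

lemma pos_of_mem {n : ℕ} {x : ℝ} (hx : x ∈ Icc (1 / ((n : ℝ) + 1)) (1 / (n : ℝ))) : 0 < x :=
  lt_of_lt_of_le (by positivity) hx.1

lemma node_pos {n : ℕ} {x : ℝ} (hx : 0 < x) (k : ℕ) : 0 < node n k x := by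
  unfold node; positivity

lemma one_le_succ_mul {n : ℕ} {x : ℝ} (hx : x ∈ Icc (1 / ((n : ℝ) + 1)) (1 / (n : ℝ))) :
    1 ≤ ((n : ℝ) + 1) * x := by
  have := hx.1
  rw [div_le_iff₀ (by positivity)] at this
  linarith

lemma node_mem_Ioc {n : ℕ} {x : ℝ} (hx : x ∈ Icc (1 / ((n : ℝ) + 1)) (1 / (n : ℝ))) (k : ℕ) :
    node n k x ∈ Ioc (0 : ℝ) 1 := by
  have hx0 := pos_of_mem hx
  refine ⟨node_pos hx0 k, inv_le_one_of_one_le₀ ((one_le_succ_mul hx).trans ?_)⟩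
  push_cast
  gcongr
  have : (0 : ℝ) ≤ k := Nat.cast_nonneg k
  linarith

lemma node_mem_Ioo {n : ℕ} {x : ℝ} (hx : x ∈ Ioo (1 / ((n : ℝ) + 1)) (1 / (n : ℝ))) (k : ℕ) :
    node n k x ∈ Ioo (0 : ℝ) 1 := by
  have hx0 := pos_of_mem (Ioo_subset_Icc_self hx)
  have h := hx.1
  rw [div_lt_iff₀ (by positivity)] at h
  refine ⟨node_pos hx0 k, inv_lt_one_of_one_lt₀ (h.trans_le ?_)⟩
  push_cast
  rw [mul_comm]
  gcongr
  have : (0 : ℝ) ≤ k := Nat.cast_nonneg k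
  linarith

lemma node_le {n : ℕ} {x : ℝ} (hx : x ∈ Icc (1 / ((n : ℝ) + 1)) (1 / (n : ℝ))) (k : ℕ) :
    node n k x ≤ node n k (1 / ((n : ℝ) + 1)) := by
  unfold node
  gcongr
  exact hx.1

lemma summable_node_rpow {x : ℝ} (hx : 0 < x) (n : ℕ) :
    Summable fun k => node n k x ^ (4 / 3 : ℝ) := by
  simpa [node] using (summable_nat_add_iff n).mpr (summable_inv_mul_rpow hx)

/-- A bound on the terms of the differentiated series that is uniform in `x`, up to and including
both endpoints. -/
lemma norm_mul_node_le {n : ℕ} {x C : ℝ} (hC0 : 0 ≤ C)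
    (hC : ∀ x ∈ Ioc (0 : ℝ) 1, |φ x| ≤ C * x ^ (1 / 3 : ℝ))
    (hx : x ∈ Icc (1 / ((n : ℝ) + 1)) (1 / (n : ℝ))) (k : ℕ) :
    ‖φ (node n k x) * node n k x‖ ≤ C * node n k (1 / ((n : ℝ) + 1)) ^ (4 / 3 : ℝ) := by
  have hm := node_mem_Ioc hx k
  have h1 : node n k x ^ (4 / 3 : ℝ) = node n k x ^ (1 / 3 : ℝ) * node n k x := by
    rw [← Real.rpow_add_one hm.1.ne']
    norm_num
  have h2 := Real.rpow_le_rpow hm.1.le (node_le hx k) (by norm_num : (0 : ℝ) ≤ 4 / 3)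
  rw [norm_mul, Real.norm_eq_abs, Real.norm_eq_abs, abs_of_pos hm.1]
  calc |φ (node n k x)| * node n k x ≤ C * node n k x ^ (1 / 3 : ℝ) * node n k x :=
        mul_le_mul_of_nonneg_right (hC _ hm) hm.1.le
    _ = C * node n k x ^ (4 / 3 : ℝ) := by rw [h1, mul_assoc]
    _ ≤ _ := mul_le_mul_of_nonneg_left h2 hC0

lemma summable_mul_node (hφ : IsEigenfunction φ lam) {n : ℕ} {x : ℝ}
    (hx : x ∈ Icc (1 / ((n : ℝ) + 1)) (1 / (n : ℝ))) :
    Summable fun k => φ (node n k x) * node n k x := by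
  obtain ⟨C, hC0, hC⟩ := hφ.exists_decay
  exact .of_norm_bounded ((summable_node_rpow (by positivity) n).mul_left C)
    (norm_mul_node_le hC0 hC hx)

lemma continuousOn_node (n k : ℕ) :
    ContinuousOn (node n k) (Icc (1 / ((n : ℝ) + 1)) (1 / (n : ℝ))) := by
  unfold node
  refine ContinuousOn.inv₀ (by fun_prop) fun x hx => ?_
  have := pos_of_mem hx
  positivity

lemma continuousOn_derivFormula (hφ : IsEigenfunction φ lam) (n : ℕ) :
    ContinuousOn (derivFormula φ lam n) (Icc (1 / ((n : ℝ) + 1)) (1 / (n : ℝ))) := by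
  obtain ⟨C, hC0, hC⟩ := hφ.exists_decay
  have hser : ContinuousOn (fun x => ∑' k : ℕ, φ (node n k x) * node n k x)
      (Icc (1 / ((n : ℝ) + 1)) (1 / (n : ℝ))) :=
    continuousOn_tsum (fun k => (hφ.continuousOn.comp (continuousOn_node n k)
      fun x hx => node_mem_Ioc hx k).mul (continuousOn_node n k))
      ((summable_node_rpow (by positivity) n).mul_left C)
      fun k x hx => norm_mul_node_le hC0 hC hx k
  exact continuousOn_const.mul ((continuousOn_const.div (continuousOn_id.pow 2)
    fun x hx => (pow_pos (pos_of_mem hx) 2).ne').sub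
    (hser.div continuousOn_id fun x hx => (pos_of_mem hx).ne'))

/-- For `x ∈ [1/(n+1), 1/n]` the first `n` terms of the expansion are constant. -/
lemma eq_tsum_node (hφ : IsEigenfunction φ lam) {n : ℕ} (hn : 1 ≤ n) {x : ℝ}
    (hx : x ∈ Icc (1 / ((n : ℝ) + 1)) (1 / (n : ℝ))) :
    φ x = lam * ((1 / 2 + n) * (∫ y in (0 : ℝ)..1, φ y) - PhiOne φ / x +
      ∑' k : ℕ, ∫ y in (0 : ℝ)..node n k x, φ y) := by
  have hx0 := pos_of_mem hx
  have hn0 : (0 : ℝ) < n := by exact_mod_cast hn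
  have hx1 : x ≤ 1 := hx.2.trans (by
    rw [div_le_one hn0]
    exact_mod_cast hn)
  rw [hφ.eq_tsum_primitive ⟨hx0, hx1⟩,
    ← (hφ.hasSum_primitive hx0).summable.sum_add_tsum_nat_add n]
  have h1 : ∀ m ∈ Finset.range n,
      ∫ y in (0 : ℝ)..min 1 (((m : ℝ) + 1) * x)⁻¹, φ y = ∫ y in (0 : ℝ)..1, φ y := by
    intro m hm
    rw [min_eq_left]
    rw [one_le_inv₀ (by positivity)]
    have hm1 : (m : ℝ) + 1 ≤ n := by exact_mod_cast Finset.mem_range.mp hm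
    have := hx.2
    rw [le_div_iff₀ hn0] at this
    nlinarith
  have h2 : ∀ k : ℕ, min 1 ((((k + n : ℕ) : ℝ) + 1) * x)⁻¹ = node n k x := fun k =>
    min_eq_right (node_mem_Ioc hx k).2
  rw [Finset.sum_congr rfl h1, Finset.sum_const, Finset.card_range, nsmul_eq_mul]
  simp_rw [h2]
  ring

lemma hasDerivAt_node {x : ℝ} (hx : 0 < x) (n k : ℕ) :
    HasDerivAt (node n k) (-(node n k x / x)) x := by
  have h := ((hasDerivAt_id x).const_mul (((k + n : ℕ) : ℝ) + 1)).inv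
    (mul_pos (Nat.cast_add_one_pos (k + n)) hx).ne'
  refine h.congr_deriv ?_
  simp only [node, id]
  field_simp

lemma hasDerivAt_primitive (hφ : IsEigenfunction φ lam) {t : ℝ} (ht : t ∈ Ioo (0 : ℝ) 1) :
    HasDerivAt (fun t => ∫ y in (0 : ℝ)..t, φ y) (φ t) t := by
  have hc : ContinuousOn φ (Ioo 0 1) := hφ.continuousOn.mono Ioo_subset_Ioc_self
  exact intervalIntegral.integral_hasDerivAt_right
    (hφ.intervalIntegrable_of_mem ⟨ht.1.le, ht.2.le⟩)
    (hc.stronglyMeasurableAtFilter isOpen_Ioo t ht) (hc.continuousAt (Ioo_mem_nhds ht.1 ht.2))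

lemma hasDerivAt_of_mem_Ioo (hφ : IsEigenfunction φ lam) {n : ℕ} (hn : 1 ≤ n) {x : ℝ}
    (hx : x ∈ Ioo (1 / ((n : ℝ) + 1)) (1 / (n : ℝ))) :
    HasDerivAt φ (derivFormula φ lam n x) x := by
  obtain ⟨C, hC0, hC⟩ := hφ.exists_decay
  have hpos : ∀ y ∈ Ioo (1 / ((n : ℝ) + 1)) (1 / (n : ℝ)), 0 < y := fun y hy =>
    pos_of_mem (Ioo_subset_Icc_self hy)
  have hx0 := hpos x hx
  have hsum0 : Summable fun k : ℕ => ∫ y in (0 : ℝ)..node n k x, φ y :=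
    .of_norm_bounded ((summable_node_rpow hx0 n).mul_left C) fun k =>
      (integral_abs_le hC0 hC (Ioc_subset_Icc_self (node_mem_Ioc (Ioo_subset_Icc_self hx) k))).1
  have hser := hasDerivAt_tsum_of_isPreconnected
    (g := fun (k : ℕ) (x : ℝ) => ∫ y in (0 : ℝ)..node n k x, φ y)
    (g' := fun k x => φ (node n k x) * (-(node n k x / x)))
    (u := fun k => (C * node n k (1 / ((n : ℝ) + 1)) ^ (4 / 3 : ℝ)) * ((n : ℝ) + 1))
    (((summable_node_rpow (by positivity) n).mul_left C).mul_right _) isOpen_Ioo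
    isPreconnected_Ioo
    (fun k y hy => (hφ.hasDerivAt_primitive (node_mem_Ioo hy k)).comp y
      (hasDerivAt_node (hpos y hy) n k))
    (fun k y hy => by
      have hy0 := hpos y hy
      have h1 : φ (node n k y) * (-(node n k y / y)) = -((φ (node n k y) * node n k y) * y⁻¹) := by
        field_simp
      have h2 : y⁻¹ ≤ (n : ℝ) + 1 := by
        rw [inv_le_comm₀ hy0 (by positivity), ← one_div]
        exact hy.1.le
      rw [h1, norm_neg, norm_mul, norm_inv, Real.norm_of_nonneg hy0.le]
      exact mul_le_mul (norm_mul_node_le hC0 hC (Ioo_subset_Icc_self hy) k) h2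
        (by positivity) (by have := node_pos (n := n) (x := 1 / ((n : ℝ) + 1)) (by positivity) k
                            positivity))
    hx hsum0 hx
  have hinv : HasDerivAt (fun y : ℝ => PhiOne φ / y) (-(PhiOne φ / x ^ 2)) x := by
    refine ((hasDerivAt_inv hx0.ne').const_mul (PhiOne φ)).congr_deriv ?_
    rw [mul_neg, ← div_eq_mul_inv]
  have hall := (((hasDerivAt_const x ((1 / 2 + n) * ∫ y in (0 : ℝ)..1, φ y)).sub hinv).add
    hser).const_mul lam
  refine (hall.congr_of_eventuallyEq ?_).congr_deriv ?_
  · filter_upwards [Ioo_mem_nhds hx.1 hx.2] with y hy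
    exact hφ.eq_tsum_node hn (Ioo_subset_Icc_self hy)
  · have h3 : ∀ k, φ (node n k x) * (-(node n k x / x)) =
        -(x⁻¹ * (φ (node n k x) * node n k x)) := fun k => by
      field_simp
    simp_rw [h3]
    rw [tsum_neg, tsum_mul_left, derivFormula]
    ring

lemma hasSum_subtype_iff {f : ℕ → ℝ} {n : ℕ} {a : ℝ} :
    HasSum (fun m : {m : ℕ // n + 1 ≤ m} => f m) a ↔ HasSum (fun k => f (k + (n + 1))) a := by
  let e : ℕ ≃ {m : ℕ // n + 1 ≤ m} :=
    { toFun := fun k => ⟨k + (n + 1), Nat.le_add_left _ _⟩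
      invFun := fun m => m - (n + 1)
      left_inv := fun k => Nat.add_sub_cancel _ _
      right_inv := fun m => Subtype.ext (Nat.sub_add_cancel m.2) }
  exact e.hasSum_iff.symm

/-- The series for `φ'`, reindexed by `m = k + n + 1`. -/
lemma hasSum_series (hφ : IsEigenfunction φ lam) {n : ℕ} {x : ℝ}
    (hx : x ∈ Icc (1 / ((n : ℝ) + 1)) (1 / (n : ℝ))) :
    HasSum (fun m : {m : ℕ // n + 1 ≤ m} => φ (1 / ((m : ℕ) * x)) / ((m : ℕ) : ℝ))
      (x * ∑' k : ℕ, φ (node n k x) * node n k x) := by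
  have hx0 := pos_of_mem hx
  rw [hasSum_subtype_iff (f := fun m : ℕ => φ (1 / ((m : ℝ) * x)) / (m : ℝ))]
  refine ((hφ.summable_mul_node hx).hasSum.mul_left x).congr_fun fun k => ?_
  have h1 : 1 / (((k + (n + 1) : ℕ) : ℝ) * x) = node n k x := by
    rw [node, one_div]
    push_cast
    ring
  rw [h1, node]
  push_cast
  field_simp
  ring

lemma derivFormula_eq (hφ : IsEigenfunction φ lam) {n : ℕ} {x : ℝ}
    (hx : x ∈ Icc (1 / ((n : ℝ) + 1)) (1 / (n : ℝ))) :
    derivFormula φ lam n x = lam * (x⁻¹) ^ 2 * (PhiOne φ -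
      ∑' m : {m : ℕ // n + 1 ≤ m}, φ (1 / ((m : ℕ) * x)) / ((m : ℕ) : ℝ)) := by
  have hx0 := pos_of_mem hx
  rw [(hφ.hasSum_series hx).tsum_eq, derivFormula]
  field_simp

end IsEigenfunction

open IsEigenfunction in
theorem theorem4p1 (φ : ℝ → ℝ) (lam : ℝ) (hφ : IsEigenfunction φ lam) :
    IntegrableOn (fun y : ℝ => φ y / y) (Icc (0 : ℝ) 1) volume ∧
    (∀ x : ℝ, 0 < x → x < 1 → (∀ k : ℤ, 1 / x ≠ (k : ℝ)) →
      DifferentiableAt ℝ φ x ∧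
      Summable (fun m : {m : ℕ // 1 / x < (m : ℝ)} =>
        φ (1 / ((m : ℕ) * x)) / ((m : ℕ) : ℝ)) ∧
      lam⁻¹ * x ^ 2 * deriv φ x =
        PhiOne φ - ∑' m : {m : ℕ // 1 / x < (m : ℝ)},
          φ (1 / ((m : ℕ) * x)) / ((m : ℕ) : ℝ)) ∧
    (∀ n : ℕ, 1 ≤ n →
      DifferentiableOn ℝ φ (Ioo (1 / ((n : ℝ) + 1)) (1 / (n : ℝ))) ∧
      ContinuousOn (deriv φ) (Ioo (1 / ((n : ℝ) + 1)) (1 / (n : ℝ))) ∧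
      Summable (fun m : {m : ℕ // n + 1 ≤ m} =>
        φ ((n : ℝ) / ((m : ℕ) : ℝ)) / ((m : ℕ) : ℝ)) ∧
      Tendsto (deriv φ) (𝓝[<] (1 / (n : ℝ)))
        (𝓝 (lam * (n : ℝ) ^ 2 *
          (PhiOne φ - ∑' m : {m : ℕ // n + 1 ≤ m},
            φ ((n : ℝ) / ((m : ℕ) : ℝ)) / ((m : ℕ) : ℝ)))) ∧
      Summable (fun m : {m : ℕ // n + 1 ≤ m} =>
        φ (((n : ℝ) + 1) / ((m : ℕ) : ℝ)) / ((m : ℕ) : ℝ)) ∧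
      Tendsto (deriv φ) (𝓝[>] (1 / ((n : ℝ) + 1)))
        (𝓝 (lam * ((n : ℝ) + 1) ^ 2 *
          (PhiOne φ - ∑' m : {m : ℕ // n + 1 ≤ m},
            φ (((n : ℝ) + 1) / ((m : ℕ) : ℝ)) / ((m : ℕ) : ℝ))))) := by
  refine ⟨?_, ?_, ?_⟩
  · rw [integrableOn_Icc_iff_integrableOn_Ioc]
    exact hφ.integrableOn_div
  · intro x hx0 hx1 hk
    set n := ⌊1 / x⌋₊ with hn
    have hx1' : 1 < 1 / x := by rwa [lt_div_iff₀ hx0, one_mul]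
    have hn1 : 1 ≤ n := Nat.le_floor (by exact_mod_cast hx1'.le)
    have hn0 : (0 : ℝ) < n := by exact_mod_cast hn1
    have hlt1 : (n : ℝ) < 1 / x := lt_of_le_of_ne (Nat.floor_le (by positivity))
      fun h => hk n (by rw [← h]; simp)
    have hlt2 : 1 / x < (n : ℝ) + 1 := Nat.lt_floor_add_one _
    have hx : x ∈ Ioo (1 / ((n : ℝ) + 1)) (1 / (n : ℝ)) :=
      ⟨by rwa [one_div_lt (by positivity) hx0], by rwa [lt_one_div hx0 hn0]⟩
    -- As `1/x` is not an integer, the index set `m > 1/x` is `m ≥ n + 1` with `n = ⌊1/x⌋`.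
    have hset : (fun m : ℕ => 1 / x < (m : ℝ)) = fun m => n + 1 ≤ m := by
      ext m
      rw [Nat.succ_le_iff, hn, Nat.floor_lt (by positivity)]
    have hd := hφ.hasDerivAt_of_mem_Ioo hn1 hx
    refine ⟨hd.differentiableAt, ?_⟩
    rw [hset]
    refine ⟨(hφ.hasSum_series (Ioo_subset_Icc_self hx)).summable, ?_⟩
    rw [hd.deriv, hφ.derivFormula_eq (Ioo_subset_Icc_self hx)]
    have := hφ.lam_ne_zero
    field_simp
  · intro n hn
    have hn0 : (0 : ℝ) < n := by exact_mod_cast hn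
    have hlt : 1 / ((n : ℝ) + 1) < 1 / (n : ℝ) := one_div_lt_one_div_of_lt hn0 (by linarith)
    have hderiv : EqOn (deriv φ) (derivFormula φ lam n) (Ioo (1 / ((n : ℝ) + 1)) (1 / (n : ℝ))) :=
      fun x hx => (hφ.hasDerivAt_of_mem_Ioo hn hx).deriv
    have hc := hφ.continuousOn_derivFormula n
    have hl := left_mem_Icc.mpr hlt.le
    have hr := right_mem_Icc.mpr hlt.le
    have earg : ∀ (a : ℝ) (m : ℕ), 1 / ((m : ℝ) * (1 / a)) = a / m := fun a m => by
      rw [mul_one_div, one_div_div]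
    have sr := (hφ.hasSum_series hr).summable
    have sl := (hφ.hasSum_series hl).summable
    have er := hφ.derivFormula_eq hr
    have el := hφ.derivFormula_eq hl
    simp only [earg] at sr sl er el
    rw [one_div, inv_inv, ← one_div] at er el
    refine ⟨fun x hx => (hφ.hasDerivAt_of_mem_Ioo hn hx).differentiableAt.differentiableWithinAt,
      (hc.mono Ioo_subset_Icc_self).congr hderiv, sr, ?_, sl, ?_⟩
    · rw [← er, ← nhdsWithin_Ioo_eq_nhdsLT hlt]
      exact ((hc _ hr).mono Ioo_subset_Icc_self).tendsto.congr'
        (eventually_nhdsWithin_of_forall fun x hx => (hderiv hx).symm)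
    · rw [← el, ← nhdsWithin_Ioo_eq_nhdsGT hlt]
      exact ((hc _ hl).mono Ioo_subset_Icc_self).tendsto.congr'
        (eventually_nhdsWithin_of_forall fun x hx => (hderiv hx).symm)
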